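/- **Theorem 4.1 (OhyamaWronskian).** The Ohyama polynomials $\rho_n(s)$, $n\in\mathbb Z$, are the polynomials determined by $\rho_0=\rho_{1}=\rho_{-1}=1$ and the recursion, for all $n\in\mathbb Z$, $$(s+n)\rho_n^2-2s\,\rho_n\ddot\rho_n+2s\,\dot\rho_n^{\,2}-2\rho_n\dot\rho_n=\begin{cases}\rho_{n+1}\rho_{n-1}, & n \text{ odd},\\ s\,\rho_{n+1}\rho_{n-1}, & n\text{ even},\end{cases}$$ where dots denote derivatives in $s$; exactly one sequence of polynomials satisfies these conditions. Moreover, there is exactly one family of real numbers $A_{m,k}$ $(m,k\in\mathbb Z)$, non-zero only if $m,k\ge 0$, such that $$\frac{k+1}{3}A_{m,k+1}-A_{m,k}+\frac{3\sqrt3}{k}A_{m-1,k-2}=0\qquad(m,k\in\mathbb Z,\ k\ne 0),$$ $$A_{m,2m}=\Big(\frac{3\sqrt3}{2}\Big)^m\frac{3^{1/4}}{m!}\ (m\ge 0),\qquad A_{m,0}=0\ (m\ge1),\qquad A_{0,k}=0\ (k\ge1).$$ Let $s=3(z/2)^{2/3}$ for $z\in\mathbb C\setminus(-\infty,0]$,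 with principal branches of all powers. For $n\in\mathbb Z\setminus\{0\}$ put $\operatorname{sgn}(n)=\pm1$ and $$W_n=\sum_{k=0}^{2|n|-2}A_{|n|-1,k}\Big(\frac{\operatorname{sgn}(n)\,s}{3}\Big)^k .$$ Then, for every $n\in\mathbb Z$, with $\delta=\operatorname{sgn}(n)$, $$\rho_n(s)=\begin{cases}3^{-1/4}\left(\dfrac s3\right)^{\frac{|n|-1}{4}}\,Wr(W_{\delta},W_{2\delta},\dots,W_n), & n\text{ odd},\\[2mm] \left(\dfrac s3\right)^{\frac{|n|}{4}}\,Wr(W_{\delta},W_{2\delta},\dots,W_n), & n\text{ even},\end{cases}$$ where $Wr(f_1,\dots,f_N)=\det\big(\tfrac{d^{\,i-1}f_j}{dz^{\,i-1}}\big)_{i,j=1}^N$ is the Wronskian in the variable $z$ (equal to $1$ for $N=0$, i.e. $n=0$). -/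

import Mathlib

open Polynomial

namespace Ohyama

/-- The bilinear differential expression
`(s + n) ρ² - 2 s ρ ρ'' + 2 s (ρ')² - 2 ρ ρ'` (derivatives in `s`), as a polynomial in `s`. -/
noncomputable def bilinear (n : ℤ) (ρ : ℂ[X]) : ℂ[X] :=
  (X + C (n : ℂ)) * ρ ^ 2 - 2 * X * ρ * derivative (derivative ρ)
    + 2 * X * (derivative ρ) ^ 2 - 2 * ρ * derivative ρ

/-- The factor of `ρ_{n+1} ρ_{n-1}` in the Ohyama recursion: `1` for odd `n`, `s` for even `n`. -/
noncomputable def parityFactor (n : ℤ) : ℂ[X] := if Even n then X else 1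

/-- A two-sided sequence of polynomials with the initial values and satisfying the recursion that
define the Ohyama polynomials. -/
structure IsOhyamaSequence (ρ : ℤ → ℂ[X]) : Prop where
  zero : ρ 0 = 1
  one : ρ 1 = 1
  neg_one : ρ (-1) = 1
  recursion : ∀ n : ℤ, bilinear n (ρ n) = parityFactor n * (ρ (n + 1) * ρ (n - 1))

/-- One half of the sequence of Ohyama polynomials: `half δ m = ρ_{δ m}` for `δ = ±1`, obtained by
solving the recursion (taken at the index `δ (m + 1)`) for the outermost member. -/
noncomputable def half (δ : ℤ) : ℕ → ℂ[X]
  | 0 => 1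
  | 1 => 1
  | m + 2 => bilinear (δ * (m + 1)) (half δ (m + 1)) / (parityFactor (δ * (m + 1)) * half δ m)

/-- The Ohyama polynomials `ρ_n`, `n ∈ ℤ`. -/
noncomputable def ohyama (n : ℤ) : ℂ[X] := half n.sign n.natAbs

/-- The conditions that specify the coefficients `A_{m,k}`. -/
structure IsEntryCoeff (A : ℤ → ℤ → ℝ) : Prop where
  support : ∀ m k : ℤ, A m k ≠ 0 → 0 ≤ m ∧ 0 ≤ k
  recursion : ∀ m k : ℤ, k ≠ 0 →
    ((k : ℝ) + 1) / 3 * A m (k + 1) - A m k + 3 * √3 / (k : ℝ) * A (m - 1) (k - 2) = 0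
  diagonal : ∀ m : ℕ, A m (2 * m) =
    (3 * √3 / 2) ^ m * ((3 : ℝ) ^ (1 / 4 : ℝ) / (m.factorial : ℝ))
  left : ∀ m : ℤ, 1 ≤ m → A m 0 = 0
  bottom : ∀ k : ℤ, 1 ≤ k → A 0 k = 0

/-- The coefficients `A_{m,k}` for `m, k ≥ 0`: row `m` vanishes beyond `k = 2m`, has the prescribed
values at `k = 2m` and at `k = 0` (for `m ≥ 1`), and is filled in by the recursion, from
`k = 2m - 1` downwards to `k = 1`. -/
noncomputable def coeffNat : ℕ → ℕ → ℝ
  | 0, k => if k = 0 then (3 : ℝ) ^ (1 / 4 : ℝ) else 0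
  | m + 1, k =>
    if k = 0 ∨ 2 * (m + 1) < k then 0
    else if k = 2 * (m + 1) then
      (3 * √3 / 2) ^ (m + 1) * ((3 : ℝ) ^ (1 / 4 : ℝ) / ((m + 1).factorial : ℝ))
    else
      ((k : ℝ) + 1) / 3 * coeffNat (m + 1) (k + 1)
        + 3 * √3 / (k : ℝ) * (if k < 2 then 0 else coeffNat m (k - 2))
  termination_by m k => (m, 2 * m + 1 - k)
  decreasing_by
  · apply Prod.Lex.right
    omega
  · apply Prod.Lex.left
    omega

/-- The coefficients `A_{m,k}` for integers `m, k`, zero if an index is negative. -/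
noncomputable def coeff (m k : ℤ) : ℝ :=
  if 0 ≤ m ∧ 0 ≤ k then coeffNat m.toNat k.toNat else 0

/-- `s = 3 (z/2)^{2/3}`, with the principal branch of the power. -/
noncomputable def sVar (z : ℂ) : ℂ := 3 * (z / 2) ^ (2 / 3 : ℂ)

/-- The Wronskian entry `W_n`, `n ≠ 0`, as a function of `z`:
`∑_{k=0}^{2|n|-2} A_{|n|-1,k} (δ s / 3)^k` with `δ = sgn n`. -/
noncomputable def entry (n : ℤ) (z : ℂ) : ℂ :=
  ∑ k ∈ Finset.range (2 * n.natAbs - 1),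
    (coeff (|n| - 1) k : ℂ) * ((n.sign : ℂ) * sVar z / 3) ^ k

/-- The Wronskian determinant of `N` functions of a complex variable (equal to `1` for `N = 0`). -/
noncomputable def wronskian {N : ℕ} (f : Fin N → ℂ → ℂ) (z : ℂ) : ℂ :=
  (Matrix.of fun i j : Fin N => iteratedDeriv i (f j) z).det

/-- `Wr(W_δ, W_{2δ}, …, W_n)` with `δ = sgn n`, the derivatives being taken in `z`. -/
noncomputable def entryWronskian (n : ℤ) (z : ℂ) : ℂ :=
  wronskian (fun j : Fin n.natAbs => entry (n.sign * ((j : ℤ) + 1))) z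

end Ohyama

/-! Up to constants the entry of index `δ (m + 1)` is `p_m(δ s)`, where `p_0 = 1` and `p_{m+1}'' -
p_{m+1}' = -s p_m`: the recursion for `A_{m,k}` is this equation read coefficientwise
(`isChain_entryPoly`). The Wronskians `τ_n = Wr(p_0, …, p_{n-1})` in `s` therefore come from
repeated Darboux transformations of `s⁻¹(∂² - ∂)` at one eigenvalue. Jacobi's identity carries an
intertwining relation along the chain; with a Riccati equation it yields the Toda equation, whose
left side is Ohyama's expression at `τ_n` and whose right side is `τ_{n+1} τ_{n-1}`
(`IsChain.structure`).

The parity factor comes from zeros at `s = 0`. By `IsChain.five_term`, `τ_n` vanishes there to order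
exactly `∑_{j<n} ⌊j/2⌋`; removing this power of `s` from the Toda equation leaves `1` or `s`
(`IsChain.exists_ohyama_half`). Negative indices follow from `s ↦ -s` and a sign. No member of the
resulting sequence is zero, so the recursion can be solved outwards, which gives uniqueness.

Finally, passing from `s` to `z` multiplies the Wronskian by powers of `ds/dz = (z/2)^{-1/3}`
(`wronskian_eval_comp`), and `prod_mul_pow_wronskianOrder` collects the scalars. -/

namespace Ohyama


/-! ### Wronskians of polynomials and Jacobi's identity -/

section PolynomialWronskian

variable {R : Type*} [CommRing R]

/-- The Wronskian determinant of the polynomials `p 0, …, p (N - 1)`. -/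
noncomputable def polyWronskian (p : ℕ → R[X]) (N : ℕ) : R[X] :=
  (Matrix.of fun i j : Fin N => derivative^[i] (p j)).det

/-- The Wronskian determinant of `p 0, …, p (N - 1), f`. -/
noncomputable def borderedWronskian (p : ℕ → R[X]) (N : ℕ) (f : R[X]) : R[X] :=
  polyWronskian (fun j => if j < N then p j else f) (N + 1)

lemma polyWronskian_zero (p : ℕ → R[X]) : polyWronskian p 0 = 1 := by
  simp [polyWronskian]

lemma polyWronskian_one (p : ℕ → R[X]) : polyWronskian p 1 = p 0 := by
  simp [polyWronskian]

lemma polyWronskian_congr {p q : ℕ → R[X]} {N : ℕ} (h : ∀ j < N, p j = q j) :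
    polyWronskian p N = polyWronskian q N := by
  unfold polyWronskian
  congr 1
  ext i j : 2
  simp [h j j.2]

lemma borderedWronskian_self (p : ℕ → R[X]) (N : ℕ) :
    borderedWronskian p N (p N) = polyWronskian p (N + 1) := by
  refine polyWronskian_congr fun j hj => ?_
  by_cases h : j < N
  · simp [h]
  · simp [show j = N by omega]

lemma borderedWronskian_eq_zero (p : ℕ → R[X]) {N j : ℕ} (hj : j < N) :
    borderedWronskian p N (p j) = 0 := by
  refine Matrix.det_zero_of_column_eq
    (i := (⟨j, by omega⟩ : Fin (N + 1))) (j := Fin.last N) ?_ fun i => ?_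
  · simp [Fin.ext_iff, hj.ne]
  · simp [hj]

/-- The bordered Wronskian is a differential operator with leading coefficient the Wronskian. -/
lemma exists_borderedWronskian_eq_sum (p : ℕ → R[X]) (N : ℕ) :
    ∃ c : ℕ → R[X], c N = polyWronskian p N ∧
      ∀ f, borderedWronskian p N f = ∑ k ∈ Finset.range (N + 1), c k * derivative^[k] f := by
  refine ⟨fun k => if h : k < N + 1 then (-1) ^ (k + N) *
    (Matrix.of fun a b : Fin N =>
      derivative^[((⟨k, h⟩ : Fin (N + 1)).succAbove a : ℕ)] (p b)).det else 0, ?_, fun f => ?_⟩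
  · have : (⟨N, Nat.lt_succ_self N⟩ : Fin (N + 1)) = Fin.last N := rfl
    simp [this, polyWronskian, ← two_mul]
  · rw [borderedWronskian, polyWronskian, Matrix.det_succ_column _ (Fin.last N),
      Finset.sum_range]
    refine Finset.sum_congr rfl fun i _ => ?_
    have hi : (i : ℕ) < N + 1 := i.2
    simp only [hi, dif_pos]
    have hsub : (Matrix.of fun i j : Fin (N + 1) =>
        derivative^[(i : ℕ)] (if (j : ℕ) < N then p j else f)).submatrix i.succAbove
          (Fin.last N).succAbove =
        Matrix.of fun a b : Fin N => derivative^[(i.succAbove a : ℕ)] (p b) := by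
      ext a b : 2
      simp
    rw [hsub]
    simp only [Matrix.of_apply, Fin.val_last, lt_irrefl, if_false]
    ring

/-- The coefficients of the operator form a left null vector of the Wronskian matrix, whose
determinant is nonzero. -/
lemma eq_zero_of_sum_eq_zero [IsDomain R] {p d : ℕ → R[X]} {M : ℕ}
    (hp : polyWronskian p M ≠ 0)
    (h : ∀ j < M, ∑ k ∈ Finset.range M, d k * derivative^[k] (p j) = 0) :
    ∀ k < M, d k = 0 := by
  have hv := Matrix.eq_zero_of_vecMul_eq_zero (v := fun k : Fin M => d k) hp (by
    ext1 j
    have := h j j.2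
    rw [Finset.sum_range] at this
    simpa [Matrix.vecMul, dotProduct] using this)
  intro k hk
  exact congrFun hv ⟨k, hk⟩

/-- Jacobi's identity for Wronskians. -/
lemma polyWronskian_mul_borderedWronskian [IsDomain R] {p : ℕ → R[X]} {N : ℕ}
    (hp : polyWronskian p (N + 1) ≠ 0) (f : R[X]) :
    polyWronskian p N * borderedWronskian p (N + 1) f =
      derivative (borderedWronskian p N f) * polyWronskian p (N + 1)
        - borderedWronskian p N f * derivative (polyWronskian p (N + 1)) := by
  obtain ⟨c, hc, hcf⟩ := exists_borderedWronskian_eq_sum p N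
  obtain ⟨e, he, hef⟩ := exists_borderedWronskian_eq_sum p (N + 1)
  set S := polyWronskian p N
  set T := polyWronskian p (N + 1) with hT
  -- Only `c k` with `k ≤ N` is known to matter; truncation makes the index shift caused by
  -- differentiating the operator harmless.
  let c' : ℕ → R[X] := fun k => if k ≤ N then c k else 0
  let d : ℕ → R[X] := fun k =>
    S * e k - (derivative (c' k) + if k = 0 then 0 else c' (k - 1)) * T
      + c' k * derivative T
  have key : ∀ f : R[X], S * borderedWronskian p (N + 1) f -
      (derivative (borderedWronskian p N f) * T - borderedWronskian p N f * derivative T) =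
      ∑ k ∈ Finset.range (N + 2), d k * derivative^[k] f := by
    intro f
    have h1 : borderedWronskian p N f =
        ∑ k ∈ Finset.range (N + 2), c' k * derivative^[k] f := by
      rw [hcf, Finset.sum_range_succ _ (N + 1)]
      simp only [c', show ¬ (N + 1 ≤ N) by omega, if_false, zero_mul, add_zero]
      exact Finset.sum_congr rfl fun k hk => by
        rw [if_pos (by have := Finset.mem_range.1 hk; omega)]
    have h2 : derivative (borderedWronskian p N f) =
        ∑ k ∈ Finset.range (N + 2),
          (derivative (c' k) + if k = 0 then 0 else c' (k - 1)) * derivative^[k] f := by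
      have h3 : ∑ k ∈ Finset.range (N + 2),
          (if k = 0 then 0 else c' (k - 1)) * derivative^[k] f =
          ∑ k ∈ Finset.range (N + 2), c' k * derivative^[k + 1] f := by
        rw [Finset.sum_range_succ', Finset.sum_range_succ _ (N + 1)]
        simp [c']
      simp only [add_mul, Finset.sum_add_distrib]
      rw [h3, h1, derivative_sum, ← Finset.sum_add_distrib]
      refine Finset.sum_congr rfl fun k _ => ?_
      rw [derivative_mul, Function.iterate_succ_apply']
    rw [h2, h1, hef]
    simp only [d, Finset.mul_sum, Finset.sum_mul, ← Finset.sum_sub_distrib]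
    exact Finset.sum_congr rfl fun k _ => by ring
  -- Both sides have leading coefficient `S * T`, so their difference has order at most `N`; it
  -- kills `p 0, …, p N`, hence vanishes.
  have hlead : d (N + 1) = 0 := by
    simp [d, c', he, hc, mul_comm]
  have hd : ∀ k < N + 1, d k = 0 := by
    refine eq_zero_of_sum_eq_zero hp fun j hj => ?_
    have hk := key (p j)
    rw [Finset.sum_range_succ, hlead, zero_mul, add_zero] at hk
    rw [← hk, borderedWronskian_eq_zero p hj]
    rcases Nat.lt_succ_iff_lt_or_eq.1 hj with h | h
    · rw [borderedWronskian_eq_zero p h]; simp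
    · rw [h, borderedWronskian_self]; ring
  have := key f
  rw [Finset.sum_range_succ, hlead, Finset.sum_eq_zero fun k hk => by
    rw [hd k (Finset.mem_range.1 hk), zero_mul]] at this
  simpa [sub_eq_zero] using this

end PolynomialWronskian


/-! ### Bilinear identities along a Darboux chain -/

section BilinearIdentities

/-- One Darboux step: `A, B, D` play consecutive Wronskians, `u, x` and `w, y` consecutive bordered
ones, and `hx`, `hy` are Jacobi's identity. -/
lemma darboux_succ {ν : ℂ} {A B D u w x y : ℂ[X]} (hA : A ≠ 0)
    (hu : X * (derivative u * A - u * derivative A) - (X + C ν) * u * A = -X ^ 2 * B * w)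
    (hD : X * (derivative D * A - D * derivative A) - (X + C ν) * D * A = -X ^ 2 * B * B)
    (hx : B * x = derivative u * D - u * derivative D)
    (hy : A * y = derivative w * B - w * derivative B) (hB : B ≠ 0) :
    X * (derivative x * B - x * derivative B) - (X + C (ν + 1)) * x * B = -X ^ 2 * D * y := by
  -- Eliminating the terms in `X + C ν` from `hu` and `hD` leaves a derivative-free relation, which
  -- is then differentiated.
  have k : A * x = X * (u * B - D * w) := by
    have : X * B * (A * x) = X * B * (X * (u * B - D * w)) := by
      linear_combination D * hu - u * hD + X * A * hx
    exact mul_left_cancel₀ (mul_ne_zero X_ne_zero hB) this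
  have k' := congrArg derivative k
  simp only [derivative_mul, derivative_sub, derivative_X] at k'
  have h2 : A ^ 2 ≠ 0 := pow_ne_zero 2 hA
  refine mul_left_cancel₀ h2 ?_
  simp only [map_add, map_one]
  linear_combination X * B * A * k' - (X * B * derivative A + X * A * derivative B + (X + C ν + 1) * A * B) * k
    + X * B * B * hu - X * B * w * hD + X ^ 2 * D * A * hy

/-- Bilinear form of the Riccati equation of the Darboux chain. -/
noncomputable def riccati (ν : ℂ) (B D : ℂ[X]) : ℂ[X] :=
  X ^ 2 * (derivative (derivative D) * B - 2 * derivative D * derivative B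
      + D * derivative (derivative B))
    - X * (X + C ν) * (derivative D * B - D * derivative B) - X * derivative B * D
    + C ν * X * B * D + C (ν * (ν - 1)) * B * D

lemma riccati_succ {ν : ℂ} {A B D : ℂ[X]} (hA : A ≠ 0)
    (hD : X * (derivative D * A - D * derivative A) - (X + C ν) * D * A = -X ^ 2 * B * B)
    (h : riccati ν A B = 0) : riccati (ν + 1) B D = 0 := by
  have hD' := congrArg derivative hD
  simp only [derivative_mul, derivative_sub, derivative_X, derivative_add, derivative_C,
    derivative_neg, derivative_X_pow, Nat.cast_ofNat, map_ofNat] at hD'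
  refine mul_left_cancel₀ hA ?_
  simp only [riccati, map_add, map_one, map_mul, map_sub, mul_zero] at h ⊢
  linear_combination D * h + X * B * hD' - (2 * X * derivative B + 2 * B) * hD

/-- The bilinear expression of the Toda equation. -/
noncomputable def toda (ν : ℂ) (f : ℂ[X]) : ℂ[X] :=
  (X + C ν) * f ^ 2 - 2 * X * f * derivative (derivative f)
    + 2 * X * (derivative f) ^ 2 - 2 * f * derivative f

/-- The correction to `h` is the numerator of the derivative of the quotient `riccati ν B D / (B *
D)`, which vanishes. -/
lemma toda_derivative_succ {ν : ℂ} {B D : ℂ[X]} (hB : B ≠ 0) (hM : riccati ν B D = 0)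
    (h : X * (2 * derivative D * toda ν B - derivative (toda ν B) * D)
      - (X + C (ν - 1)) * toda ν B * D = -X ^ 2 * B ^ 2 * D) :
    X * (derivative (toda (ν + 1) D) * B - 2 * toda (ν + 1) D * derivative B)
      - (X + C ν) * toda (ν + 1) D * B = -X ^ 2 * D ^ 2 * B := by
  have hM' := congrArg derivative hM
  refine mul_left_cancel₀ hB ?_
  simp only [riccati, toda, derivative_mul, derivative_X, derivative_C,
    derivative_pow, derivative_ofNat, derivative_zero, derivative_one,
    Nat.cast_ofNat, map_ofNat, map_add, map_one, map_mul, map_sub] at h hM hM' ⊢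
  linear_combination D * h - 2 * (hM' * B * D - hM * (derivative B * D + B * derivative D))

/-- Degrees: for `d ≠ 0` the right side has degree `1 + deg d + deg B`, while each derivative lowers
the left side strictly below that. -/
lemma eq_zero_of_derivative_eq {ν : ℂ} {d B : ℂ[X]} (hB : B ≠ 0)
    (h : X * (derivative d * B - 2 * d * derivative B) = (X + C ν) * d * B) : d = 0 := by
  by_contra hd
  have h1 : ((X + C ν) * d * B).degree = 1 + d.degree + B.degree := by
    rw [degree_mul, degree_mul, degree_X_add_C]
  have h2 : (derivative d * B - 2 * d * derivative B).degree < d.degree + B.degree := by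
    have hB' : B.degree ≠ ⊥ := degree_ne_bot.2 hB
    have hd' : d.degree ≠ ⊥ := degree_ne_bot.2 hd
    refine (degree_sub_le _ _).trans_lt (max_lt ?_ ?_)
    · rw [degree_mul]
      exact WithBot.add_lt_add_right hB' (degree_derivative_lt hd)
    · rw [mul_assoc, ← C_ofNat, degree_C_mul two_ne_zero, degree_mul]
      exact WithBot.add_lt_add_left hd' (degree_derivative_lt hB)
  rw [← h, degree_mul, degree_X, add_assoc] at h1
  have h3 := WithBot.add_lt_add_left (x := (1 : WithBot ℕ)) WithBot.one_ne_bot h2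
  exact h3.ne h1

/-- `toda (ν + 1) D` and `E * B` solve the same inhomogeneous first-order equation, and the
homogeneous one has no nonzero polynomial solution. -/
lemma toda_succ {ν : ℂ} {A B D E : ℂ[X]} (hB : B ≠ 0) (hM : riccati ν B D = 0)
    (hD : X * (derivative D * A - D * derivative A) - (X + C (ν - 1)) * D * A = -X ^ 2 * B * B)
    (hE : X * (derivative E * B - E * derivative B) - (X + C ν) * E * B = -X ^ 2 * D * D)
    (hT : toda ν B = D * A) : toda (ν + 1) D = E * B := by
  have h : X * (2 * derivative D * toda ν B - derivative (toda ν B) * D)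
      - (X + C (ν - 1)) * toda ν B * D = -X ^ 2 * B ^ 2 * D := by
    rw [hT, derivative_mul]
    linear_combination D * hD
  have h2 := toda_derivative_succ hB hM h
  refine (sub_eq_zero.1 (eq_zero_of_derivative_eq (ν := ν) hB ?_)).symm
  simp only [derivative_sub, derivative_mul]
  linear_combination B * hE - h2

/-- The two Toda equations introduce `E` and `Z`; in their difference the second derivatives of `D`
and `A` combine into the derivative of `hD`. -/
lemma five_term_succ {ν : ℂ} {Z A B D E : ℂ[X]} (hA : A ≠ 0) (hB : B ≠ 0)
    (hD : X * (derivative D * A - D * derivative A) - (X + C (ν - 1)) * D * A = -X ^ 2 * B * B)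
    (hTE : toda (ν + 1) D = E * B) (hTZ : toda (ν - 1) A = B * Z)
    (hG : D * Z + 2 * X ^ 2 * (derivative B * A - B * derivative A)
      = (X ^ 2 + C (4 * ν - 3) * X) * B * A) :
    E * A + 2 * X ^ 2 * (derivative D * B - D * derivative B)
      = (X ^ 2 + C (4 * ν + 1) * X) * D * B := by
  have hD' := congrArg derivative hD
  refine mul_left_cancel₀ (mul_ne_zero hB hA) ?_
  simp only [toda, derivative_mul, derivative_X, derivative_C,
    derivative_neg, derivative_X_pow, Nat.cast_ofNat, map_ofNat, map_add, map_one, map_mul,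
    map_sub, derivative_one] at hD hD' hG hTE hTZ ⊢
  linear_combination -A ^ 2 * hTE + D ^ 2 * hTZ + B * D * hG - 2 * A * D * hD'
    + 2 * (derivative A * D + A * derivative D) * hD

end BilinearIdentities


/-! ### Wronskians of a chain: intertwining, Toda and five-term relations -/

section Chain

/-- A chain of polynomials `p 0 = 1, p 1, …` for the operator `X⁻¹ (∂² - ∂)`. -/
structure IsChain (p : ℕ → ℂ[X]) : Prop where
  zero : p 0 = 1
  succ : ∀ m, derivative (derivative (p (m + 1))) - derivative (p (m + 1)) = -X * p m

variable {p : ℕ → ℂ[X]}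

lemma IsChain.derivative_one (h : IsChain p) : derivative (p 1) = X + 1 := by
  have h1 := h.succ 0
  rw [h.zero] at h1
  have h2 : derivative (derivative (p 1) - (X + 1)) = derivative (p 1) - (X + 1) := by
    simp only [derivative_sub, derivative_add, derivative_X, Polynomial.derivative_one]
    linear_combination h1
  by_contra h3
  have h4 := degree_derivative_lt (sub_ne_zero.2 h3)
  rw [h2] at h4
  exact lt_irrefl _ h4

lemma borderedWronskian_zero (p : ℕ → ℂ[X]) (f : ℂ[X]) : borderedWronskian p 0 f = f := by
  simp [borderedWronskian, polyWronskian_one]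

lemma borderedWronskian_one (h : IsChain p) (f : ℂ[X]) :
    borderedWronskian p 1 f = derivative f := by
  have := polyWronskian_mul_borderedWronskian (p := p) (N := 0)
    (by rw [polyWronskian_one, h.zero]; exact one_ne_zero) f
  simpa [polyWronskian_zero, polyWronskian_one, h.zero, borderedWronskian_zero] using this

/-- The factored form of the intertwining relation of the `n`-th Darboux transformation. -/
def Intertwines (p : ℕ → ℂ[X]) (n : ℕ) : Prop :=
  ∀ j, X * (derivative (borderedWronskian p (n + 1) (p (j + 1))) * polyWronskian p n
      - borderedWronskian p (n + 1) (p (j + 1)) * derivative (polyWronskian p n))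
    - (X + C (n : ℂ)) * borderedWronskian p (n + 1) (p (j + 1)) * polyWronskian p n
    = -X ^ 2 * polyWronskian p (n + 1) * borderedWronskian p n (p j)

lemma Intertwines.diagonal {n : ℕ} (h : Intertwines p n) :
    X * (derivative (polyWronskian p (n + 2)) * polyWronskian p n
      - polyWronskian p (n + 2) * derivative (polyWronskian p n))
    - (X + C (n : ℂ)) * polyWronskian p (n + 2) * polyWronskian p n
    = -X ^ 2 * polyWronskian p (n + 1) * polyWronskian p (n + 1) := by
  simpa only [borderedWronskian_self] using h n

lemma Intertwines.succ {n : ℕ} (h : Intertwines p n) (h0 : polyWronskian p n ≠ 0)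
    (h1 : polyWronskian p (n + 1) ≠ 0) (h2 : polyWronskian p (n + 2) ≠ 0) :
    Intertwines p (n + 1) := by
  intro j
  have := darboux_succ h0 (h j) h.diagonal
    (polyWronskian_mul_borderedWronskian h2 (p (j + 1)))
    (polyWronskian_mul_borderedWronskian h1 (p j)) h1
  rw [Nat.cast_succ]
  exact this

lemma natDegree_X_mul_derivative_le (f : ℂ[X]) :
    (X * derivative f).natDegree ≤ f.natDegree := by
  rcases Nat.eq_zero_or_pos f.natDegree with h | h
  · simp [derivative_of_natDegree_zero h]
  · refine natDegree_mul_le.trans ?_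
    have := natDegree_derivative_lt h.ne'
    rw [natDegree_X]
    omega

/-- The term `(X + C ν) * f ^ 2` has degree `2 deg f + 1`, more than all others. Through the Toda
equation this makes the next Wronskian nonzero. -/
lemma toda_ne_zero {ν : ℂ} {f : ℂ[X]} (hf : f ≠ 0) : toda ν f ≠ 0 := by
  intro h
  have h1 : ((X + C ν) * f ^ 2).natDegree = 1 + 2 * f.natDegree := by
    rw [natDegree_mul (X_add_C_ne_zero ν) (pow_ne_zero 2 hf), natDegree_pow, natDegree_X_add_C]
  have h3 : (X + C ν) * f ^ 2 = f * (C 2 * (X * derivative (derivative f)))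
      - derivative f * (C 2 * (X * derivative f)) + f * (C 2 * derivative f) := by
    rw [toda] at h
    simp only [map_ofNat]
    linear_combination h
  have hd : (derivative f).natDegree ≤ f.natDegree :=
    (natDegree_derivative_le f).trans (Nat.sub_le _ _)
  have h4 : (C 2 * (X * derivative (derivative f))).natDegree ≤ f.natDegree :=
    (natDegree_C_mul_le _ _).trans ((natDegree_X_mul_derivative_le _).trans hd)
  have h5 : (C 2 * (X * derivative f)).natDegree ≤ f.natDegree :=
    (natDegree_C_mul_le _ _).trans (natDegree_X_mul_derivative_le _)
  have h6 : (C 2 * derivative f).natDegree ≤ f.natDegree :=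
    (natDegree_C_mul_le _ _).trans hd
  have h7 : ((X + C ν) * f ^ 2).natDegree ≤ 2 * f.natDegree := by
    rw [h3, two_mul]
    exact natDegree_add_le_of_degree_le
      (natDegree_sub_le_of_le (natDegree_mul_le_of_le le_rfl h4) (natDegree_mul_le_of_le hd h5) |>.trans
        (max_self _).le) (natDegree_mul_le_of_le le_rfl h6)
  omega

lemma IsChain.structure (h : IsChain p) (n : ℕ) :
    polyWronskian p n ≠ 0 ∧ polyWronskian p (n + 1) ≠ 0 ∧ polyWronskian p (n + 2) ≠ 0 ∧
      Intertwines p n ∧ riccati n (polyWronskian p n) (polyWronskian p (n + 1)) = 0 ∧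
      toda (n + 1 : ℕ) (polyWronskian p (n + 1)) = polyWronskian p (n + 2) * polyWronskian p n := by
  induction n with
  | zero =>
    have h2 : polyWronskian p 2 = X + 1 := by
      rw [← borderedWronskian_self, borderedWronskian_one h, h.derivative_one]
    refine ⟨?_, ?_, ?_, ?_, ?_, ?_⟩
    · simp [polyWronskian_zero]
    · simp [polyWronskian_one, h.zero]
    · rw [zero_add, h2]; exact X_add_C_ne_zero 1
    · intro j
      have := h.succ j
      simp only [zero_add, borderedWronskian_one h, borderedWronskian_zero, polyWronskian_zero,
        polyWronskian_one, h.zero, Nat.cast_zero, C_0, Polynomial.derivative_one]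
      linear_combination X * this
    · simp [riccati, polyWronskian_zero, polyWronskian_one, h.zero]
    · simp [toda, h2, polyWronskian_zero, polyWronskian_one, h.zero]
  | succ n ih =>
    obtain ⟨h0, h1, h2, hF, hM, hT⟩ := ih
    have hF' := hF.succ h0 h1 h2
    have hM' := riccati_succ h0 hF.diagonal hM
    rw [← Nat.cast_succ] at hM'
    have hT' : toda (n + 1 + 1 : ℕ) (polyWronskian p (n + 2)) =
        polyWronskian p (n + 3) * polyWronskian p (n + 1) := by
      have := toda_succ (ν := (n + 1 : ℕ)) h1 hM' (by
        simpa using hF.diagonal) hF'.diagonal hT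
      rw [Nat.cast_succ (n + 1)]
      exact this
    refine ⟨h1, h2, fun h3 => ?_, hF', hM', hT'⟩
    rw [show n + 1 + 2 = n + 3 from rfl] at h3
    rw [h3, zero_mul] at hT'
    exact toda_ne_zero h2 hT'

/-- Needed for the order at `0`: the value of the Toda expression there may cancel, whereas the
coefficient `4n + 5` here is large enough to prevent this. -/
lemma IsChain.five_term (h : IsChain p) (n : ℕ) :
    polyWronskian p (n + 3) * polyWronskian p n
      + 2 * X ^ 2 * (derivative (polyWronskian p (n + 2)) * polyWronskian p (n + 1)
        - polyWronskian p (n + 2) * derivative (polyWronskian p (n + 1)))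
      = (X ^ 2 + C (4 * n + 5 : ℂ) * X) * polyWronskian p (n + 2) * polyWronskian p (n + 1) := by
  induction n with
  | zero =>
    have h2 : polyWronskian p 2 = X + 1 := by
      rw [← borderedWronskian_self, borderedWronskian_one h, h.derivative_one]
    have h3 := (h.structure 1).2.2.2.2.2
    simp [toda, h2, polyWronskian_zero, polyWronskian_one, h.zero] at h3 ⊢
    simp only [map_ofNat] at h3 ⊢
    rw [← h3]
    ring
  | succ n ih =>
    obtain ⟨-, h1, h2, -, -, hTZ⟩ := h.structure n
    have hD := (h.structure (n + 1)).2.2.2.1.diagonal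
    have hTE := (h.structure (n + 2)).2.2.2.2.2
    have hν : ((n + 1 : ℕ) : ℂ) = (n + 2 : ℂ) - 1 := by push_cast; ring
    have hν' : ((n + 3 : ℕ) : ℂ) = (n + 2 : ℂ) + 1 := by push_cast; ring
    rw [hν] at hD hTZ
    simp only [add_assoc, Nat.reduceAdd] at hD hTE hTZ ih ⊢
    rw [hν'] at hTE
    rw [show (4 * (n : ℂ) + 5) = 4 * (n + 2 : ℂ) - 3 by ring] at ih
    have := five_term_succ h1 h2 hD hTE hTZ ih
    rw [this]
    congr 5
    push_cast
    ring

end Chain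


/-! ### Order of vanishing at the origin and the parity factor -/

section VanishingOrder

/-- The order of vanishing at `0` of the Wronskian of the first `N` members of a chain. -/
def wronskianOrder : ℕ → ℕ
  | 0 => 0
  | n + 1 => wronskianOrder n + n / 2

lemma wronskianOrder_succ (n : ℕ) : wronskianOrder (n + 1) = wronskianOrder n + n / 2 := rfl

lemma wronskianOrder_add_two (n : ℕ) : wronskianOrder (n + 2) = wronskianOrder n + n := by
  rw [wronskianOrder_succ, wronskianOrder_succ]
  omega

lemma X_mul_derivative_X_pow_mul (a : ℕ) (f : ℂ[X]) :
    X * derivative (X ^ a * f) = X ^ a * (C (a : ℂ) * f + X * derivative f) := by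
  rw [derivative_mul]
  rcases a with _ | a
  · simp
  · rw [derivative_X_pow, Nat.add_sub_cancel]
    ring

/-- With the Euler operator `θ = X ∂` the derivative part is `-2 f² θ² log f`, and `θ²` kills `log
X^a`. Hence the homogeneity in `toda_X_pow_mul`. -/
lemma X_mul_toda (ν : ℂ) (f : ℂ[X]) :
    X * toda ν f = X * (X + C ν) * f ^ 2 - 2 * f * (X * derivative (X * derivative f))
      + 2 * (X * derivative f) ^ 2 := by
  simp only [toda, derivative_mul, derivative_X]
  ring

lemma toda_X_pow_mul (ν : ℂ) (a : ℕ) (f : ℂ[X]) :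
    toda ν (X ^ a * f) = X ^ (2 * a) * toda ν f := by
  refine mul_left_cancel₀ X_ne_zero ?_
  rw [mul_left_comm, X_mul_toda, X_mul_toda, X_mul_derivative_X_pow_mul,
    X_mul_derivative_X_pow_mul]
  simp only [derivative_add, derivative_mul, derivative_C, derivative_X]
  ring

variable {p : ℕ → ℂ[X]}

lemma IsChain.exists_reduced_succ (h : IsChain p) {n : ℕ} {f g k : ℂ[X]} (hf0 : f.coeff 0 ≠ 0)
    (hg0 : g.coeff 0 ≠ 0) (hk0 : k.coeff 0 ≠ 0)
    (hf : polyWronskian p n = X ^ wronskianOrder n * f)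
    (hg : polyWronskian p (n + 1) = X ^ wronskianOrder (n + 1) * g)
    (hk : polyWronskian p (n + 2) = X ^ wronskianOrder (n + 2) * k) :
    ∃ q : ℂ[X], q.coeff 0 ≠ 0 ∧ polyWronskian p (n + 3) = X ^ wronskianOrder (n + 3) * q := by
  have hG := h.five_term n
  obtain ⟨b, hb⟩ : ∃ b, wronskianOrder (n + 1) = b := ⟨_, rfl⟩
  obtain ⟨a, ha⟩ : ∃ a, wronskianOrder n = a := ⟨_, rfl⟩
  obtain ⟨d, hd⟩ : ∃ d, (n + 1) / 2 = d := ⟨_, rfl⟩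
  have hc : wronskianOrder (n + 2) = b + d := by rw [wronskianOrder_succ, hb, hd]
  have he : wronskianOrder (n + 3) + a = 2 * b + d + 1 := by
    have h1 := wronskianOrder_add_two (n + 1)
    have h2 := wronskianOrder_succ n
    simp only [add_assoc, Nat.reduceAdd] at h1
    omega
  set H : ℂ[X] := (X + C (4 * n + 5 - 2 * d : ℂ)) * k * g
    - 2 * (X * derivative k * g - k * (X * derivative g)) with hH
  -- At `0` only the factor `4n + 5 - 2d` survives, positive because `2d ≤ n + 1`.
  have hH0 : H.coeff 0 ≠ 0 := by
    have : H.coeff 0 = ((4 * n + 5 - 2 * d : ℕ) : ℂ) * k.coeff 0 * g.coeff 0 := by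
      rw [Nat.cast_sub (by omega)]
      simp [hH, mul_coeff_zero]
    rw [this]
    exact mul_ne_zero (mul_ne_zero (Nat.cast_ne_zero.2 (by omega)) hk0) hg0
  have key : polyWronskian p (n + 3) * f = X ^ wronskianOrder (n + 3) * H := by
    refine mul_left_cancel₀ (pow_ne_zero a X_ne_zero) ?_
    have hdk := X_mul_derivative_X_pow_mul (b + d) k
    have hdg := X_mul_derivative_X_pow_mul b g
    rw [hf, hg, hk, ha, hb, hc] at hG
    rw [← mul_assoc, ← mul_assoc (X ^ a), ← pow_add, add_comm a, he, hH]
    push_cast at hdk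
    simp only [map_add, map_sub, map_mul, map_ofNat] at hG hdk hdg ⊢
    linear_combination hG - 2 * X * X ^ b * g * hdk + 2 * X * X ^ (b + d) * k * hdg
  obtain ⟨q, hq⟩ := prime_X.pow_dvd_of_dvd_mul_right _ (mt X_dvd_iff.1 hf0)
    (Dvd.intro _ key.symm)
  refine ⟨q, fun h0 => hH0 ?_, hq⟩
  rw [hq, mul_assoc] at key
  rw [← mul_left_cancel₀ (pow_ne_zero _ X_ne_zero) key, mul_coeff_zero, h0, zero_mul]

lemma IsChain.exists_reduced (h : IsChain p) : ∀ n : ℕ, ∃ q : ℂ[X], q.coeff 0 ≠ 0 ∧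
    polyWronskian p n = X ^ wronskianOrder n * q
  | 0 => ⟨1, by simp, by simp [polyWronskian_zero, wronskianOrder]⟩
  | 1 => ⟨1, by simp, by simp [polyWronskian_one, h.zero, wronskianOrder]⟩
  | 2 => ⟨X + 1, by simp, by
      rw [← borderedWronskian_self, borderedWronskian_one h, h.derivative_one]
      simp [wronskianOrder]⟩
  | n + 3 => by
    obtain ⟨f, hf0, hf⟩ := h.exists_reduced n
    obtain ⟨g, hg0, hg⟩ := h.exists_reduced (n + 1)
    obtain ⟨k, hk0, hk⟩ := h.exists_reduced (n + 2)
    exact h.exists_reduced_succ hf0 hg0 hk0 hf hg hk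

lemma IsChain.exists_ohyama_half (h : IsChain p) : ∃ σ : ℕ → ℂ[X], σ 0 = 1 ∧ σ 1 = 1 ∧
    (∀ n, σ n ≠ 0) ∧ (∀ n, polyWronskian p n = X ^ wronskianOrder n * σ n) ∧
    ∀ n : ℕ, toda (n + 1 : ℕ) (σ (n + 1)) =
      parityFactor (n + 1 : ℕ) * (σ (n + 2) * σ n) := by
  choose σ hσ0 hσ using h.exists_reduced
  refine ⟨σ, ?_, ?_, fun n hn => hσ0 n (by simp [hn]), hσ, fun n => ?_⟩
  · simpa [polyWronskian_zero, wronskianOrder] using (hσ 0).symm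
  · simpa [polyWronskian_one, h.zero, wronskianOrder] using (hσ 1).symm
  · have hT := (h.structure n).2.2.2.2.2
    rw [hσ n, hσ (n + 1), hσ (n + 2), toda_X_pow_mul] at hT
    refine mul_left_cancel₀ (pow_ne_zero (2 * wronskianOrder (n + 1)) X_ne_zero) ?_
    -- The leftover power of `X` is `⌊(n + 1)/2⌋ - ⌊n/2⌋`: one for even `n + 1`, zero otherwise.
    rw [hT, wronskianOrder_succ (n + 1), wronskianOrder_succ n, parityFactor]
    split_ifs with hn
    · have hn' : Even (n + 1) := by exact_mod_cast hn
      obtain ⟨m, hm⟩ := hn'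
      rw [show (n + 1) / 2 = n / 2 + 1 by omega]
      ring
    · have hn' : ¬ Even (n + 1) := by exact_mod_cast hn
      rw [Nat.even_iff] at hn'
      rw [show (n + 1) / 2 = n / 2 by omega]
      ring

end VanishingOrder

/-! ### Extension to negative indices and uniqueness -/

section Sequence

/-- The sign relating `ρ (-n)` to the reflection of `ρ n`. -/
noncomputable def reflectionSign (n : ℕ) : ℂ := if Even n then (-1) ^ (n / 2) else 1

lemma bilinear_eq_toda (n : ℤ) (f : ℂ[X]) : bilinear n f = toda n f := rfl

lemma toda_neg_comp (ν : ℂ) (f : ℂ[X]) :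
    toda (-ν) (f.comp (-X)) = -(toda ν f).comp (-X) := by
  simp only [toda, derivative_comp, derivative_mul, derivative_X, add_comp,
    sub_comp, mul_comp, pow_comp, X_comp, C_comp, ofNat_comp, map_neg]
  simp
  ring

lemma toda_C_mul (ν c : ℂ) (f : ℂ[X]) : toda ν (C c * f) = C c ^ 2 * toda ν f := by
  simp only [toda, derivative_C_mul]
  ring

/-- Extension to negative indices of a solution of the recursion for positive indices. -/
noncomputable def extend (σ : ℕ → ℂ[X]) (n : ℤ) : ℂ[X] :=
  if 0 ≤ n then σ n.natAbs else C (reflectionSign n.natAbs) * (σ n.natAbs).comp (-X)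

variable {σ : ℕ → ℂ[X]}

lemma extend_natCast (n : ℕ) : extend σ n = σ n := by simp [extend]

lemma extend_neg_natCast (h0 : σ 0 = 1) (n : ℕ) :
    extend σ (-n) = C (reflectionSign n) * (σ n).comp (-X) := by
  rcases n with _ | n
  · simp [extend, reflectionSign, h0]
  · rw [extend, if_neg (by push_cast; omega), Int.natAbs_neg, Int.natAbs_natCast]

lemma reflectionSign_sq (n : ℕ) : reflectionSign n ^ 2 = 1 := by
  unfold reflectionSign
  split_ifs
  · rw [← pow_mul, mul_comm, pow_mul]; simp
  · simp

lemma reflectionSign_mul (n : ℕ) : reflectionSign (n + 2) * reflectionSign n =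
    if Even n then -1 else 1 := by
  unfold reflectionSign
  by_cases h : Even n
  · have h2 : Even (n + 2) := by rw [Nat.even_add]; simp [h]
    rw [if_pos h, if_pos h, if_pos h2, show (n + 2) / 2 = n / 2 + 1 by omega, pow_succ,
      mul_right_comm, ← pow_add, ← two_mul, pow_mul]
    simp
  · have h2 : ¬ Even (n + 2) := by rw [Nat.even_add]; simp [h]
    rw [if_neg h, if_neg h, if_neg h2, one_mul]

/-- Reflection negates the Toda expression. At even indices the sign is absorbed by `X ↦ -X`; at odd
indices it must come from the neighbouring reflection signs. -/
lemma parityFactor_neg_comp (n : ℕ) :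
    -(parityFactor (n + 1 : ℕ)).comp (-X) =
      parityFactor (-(n + 1 : ℕ)) * C (reflectionSign (n + 2) * reflectionSign n) := by
  rw [reflectionSign_mul]
  have h1 : Even (-((n + 1 : ℕ) : ℤ)) ↔ Even (n + 1) := by
    rw [even_neg]; exact_mod_cast Iff.rfl
  have h2 : Even (((n + 1 : ℕ) : ℤ)) ↔ Even (n + 1) := by exact_mod_cast Iff.rfl
  simp only [parityFactor, h1, h2, Nat.even_add_one]
  by_cases h : Even n <;> simp [h]

lemma isOhyamaSequence_extend (h0 : σ 0 = 1) (h1 : σ 1 = 1)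
    (h : ∀ n : ℕ, toda (n + 1 : ℕ) (σ (n + 1)) = parityFactor (n + 1 : ℕ) * (σ (n + 2) * σ n)) :
    IsOhyamaSequence (extend σ) where
  zero := by simp [extend, h0]
  one := by simp [extend, h1]
  neg_one := by simp [extend, h1, reflectionSign]
  recursion n := by
    rw [bilinear_eq_toda]
    obtain ⟨m, rfl | rfl⟩ := n.eq_nat_or_neg
    · rcases m with _ | m
      · simp [extend, h0, h1, reflectionSign, toda, parityFactor]
      · have e1 : ((m + 1 : ℕ) : ℤ) + 1 = (m + 2 : ℕ) := by push_cast; ring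
        have e2 : ((m + 1 : ℕ) : ℤ) - 1 = (m : ℕ) := by push_cast; ring
        rw [e1, e2, extend_natCast, extend_natCast, extend_natCast]
        exact h m
    · rcases m with _ | m
      · simp [extend, h0, h1, reflectionSign, toda, parityFactor]
      · have e1 : -((m + 1 : ℕ) : ℤ) + 1 = -(m : ℕ) := by push_cast; ring
        have e2 : -((m + 1 : ℕ) : ℤ) - 1 = -(m + 2 : ℕ) := by push_cast; ring
        rw [e1, e2, extend_neg_natCast h0, extend_neg_natCast h0, extend_neg_natCast h0]
        have := h m
        push_cast [toda_C_mul] at this ⊢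
        rw [← C_pow, reflectionSign_sq, C_1, one_mul]
        have e3 := toda_neg_comp (m + 1 : ℂ) (σ (m + 1))
        have e4 := parityFactor_neg_comp m
        rw [this, mul_comp, mul_comp] at e3
        push_cast at e4
        rw [e3, ← neg_mul, e4, C_mul]
        ring

lemma extend_ne_zero (h : ∀ n, σ n ≠ 0) (n : ℤ) : extend σ n ≠ 0 := by
  unfold extend
  split_ifs
  · exact h _
  · refine mul_ne_zero (C_ne_zero.2 fun h0 => ?_) fun h0 => h n.natAbs ?_
    · simpa [h0] using reflectionSign_sq n.natAbs
    · simpa using congrArg (fun q => q.comp (-X)) h0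

lemma parityFactor_ne_zero (n : ℤ) : parityFactor n ≠ 0 := by
  unfold parityFactor
  split_ifs
  · exact X_ne_zero
  · exact one_ne_zero

/-- Two-sided induction, cancelling the inner neighbour; only one of the two sequences has to be
known nonzero. -/
lemma IsOhyamaSequence.eq_of_ne_zero {ρ τ : ℤ → ℂ[X]} (hρ : IsOhyamaSequence ρ)
    (hτ : IsOhyamaSequence τ) (h0 : ∀ n, ρ n ≠ 0) : τ = ρ := by
  have key : ∀ n : ℕ, (τ n = ρ n ∧ τ (n + 1) = ρ (n + 1)) ∧
      (τ (-n) = ρ (-n) ∧ τ (-n - 1) = ρ (-n - 1)) := by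
    intro n
    induction n with
    | zero => simp [hρ.zero, hτ.zero, hρ.one, hτ.one, hρ.neg_one, hτ.neg_one]
    | succ n ih =>
      obtain ⟨⟨h1, h2⟩, h3, h4⟩ := ih
      have e1 := (hτ.recursion (n + 1)).symm.trans (h2 ▸ hρ.recursion (n + 1))
      have e2 := (hτ.recursion (-n - 1)).symm.trans (h4 ▸ hρ.recursion (-n - 1))
      rw [add_sub_cancel_right, h1] at e1
      rw [sub_add_cancel, h3] at e2
      have e3 := mul_right_cancel₀ (h0 _) (mul_left_cancel₀ (parityFactor_ne_zero _) e1)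
      have e4 := mul_left_cancel₀ (h0 _) (mul_left_cancel₀ (parityFactor_ne_zero _) e2)
      push_cast
      rw [show -((n : ℤ) + 1) = -n - 1 by ring]
      exact ⟨⟨h2, e3⟩, h4, e4⟩
  funext n
  obtain ⟨m, rfl | rfl⟩ := n.eq_nat_or_neg
  · exact (key m).1.1
  · exact (key m).2.1

lemma IsOhyamaSequence.half_eq {ρ : ℤ → ℂ[X]} (hρ : IsOhyamaSequence ρ) (h0 : ∀ n, ρ n ≠ 0)
    {δ : ℤ} (hδ : δ = 1 ∨ δ = -1) (n : ℕ) :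
    half δ n = ρ (δ * n) ∧ half δ (n + 1) = ρ (δ * (n + 1)) := by
  induction n with
  | zero =>
    rcases hδ with rfl | rfl
    · simp [half, hρ.zero, hρ.one]
    · simp [half, hρ.zero, hρ.neg_one]
  | succ n ih =>
    obtain ⟨h1, h2⟩ := ih
    push_cast
    refine ⟨h2, ?_⟩
    rw [half, h1, h2, hρ.recursion]
    have hne : parityFactor (δ * (n + 1)) * ρ (δ * n) ≠ 0 :=
      mul_ne_zero (parityFactor_ne_zero _) (h0 _)
    rw [show (ρ (δ * (n + 1) + 1) * ρ (δ * (n + 1) - 1)) =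
      ρ (δ * n) * ρ (δ * (n + 1 + 1)) by
        rcases hδ with rfl | rfl
        · rw [mul_comm]; congr 2; all_goals ring
        · congr 2; all_goals ring]
    rw [← mul_assoc, mul_div_cancel_left₀ _ hne]

lemma IsOhyamaSequence.ohyama_eq {ρ : ℤ → ℂ[X]} (hρ : IsOhyamaSequence ρ) (h0 : ∀ n, ρ n ≠ 0) :
    ohyama = ρ := by
  funext n
  rcases lt_trichotomy n 0 with hn | rfl | hn
  · rw [ohyama, Int.sign_eq_neg_one_of_neg hn, (hρ.half_eq h0 (Or.inr rfl) _).1]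
    congr 1; omega
  · simp [ohyama, half, hρ.zero]
  · rw [ohyama, Int.sign_eq_one_of_pos hn, (hρ.half_eq h0 (Or.inl rfl) _).1]
    congr 1; omega

end Sequence


/-! ### The coefficients `A_{m,k}` and their generating polynomials -/

section Coefficients

lemma coeff_natCast (m k : ℕ) : coeff m k = coeffNat m k := by
  simp [coeff]

lemma coeff_of_neg {m k : ℤ} (h : m < 0 ∨ k < 0) : coeff m k = 0 := by
  rw [coeff, if_neg (by omega)]

lemma coeffNat_zero_right (m : ℕ) : coeffNat (m + 1) 0 = 0 := by
  rw [coeffNat]; simp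

lemma coeffNat_zero_left (k : ℕ) : coeffNat 0 (k + 1) = 0 := by
  rw [coeffNat]; simp

lemma coeffNat_of_lt {m k : ℕ} (h : 2 * m < k) : coeffNat m k = 0 := by
  rcases m with _ | m
  · obtain ⟨k, rfl⟩ : ∃ l, k = l + 1 := ⟨k - 1, by omega⟩
    exact coeffNat_zero_left k
  · rw [coeffNat, if_pos (Or.inr h)]

lemma coeffNat_diagonal (m : ℕ) : coeffNat m (2 * m) =
    (3 * √3 / 2) ^ m * ((3 : ℝ) ^ (1 / 4 : ℝ) / (m.factorial : ℝ)) := by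
  rcases m with _ | m
  · rw [coeffNat]; simp
  · rw [coeffNat, if_neg (by omega), if_pos rfl]

lemma coeffNat_recursion (m k : ℕ) : ((k : ℝ) + 1 + 1) / 3 * coeffNat (m + 1) (k + 2)
    - coeffNat (m + 1) (k + 1) + 3 * √3 / ((k : ℝ) + 1) * (if k = 0 then 0 else coeffNat m (k - 1))
      = 0 := by
  rcases lt_trichotomy (k + 1) (2 * (m + 1)) with h | h | h
  · have : coeffNat (m + 1) (k + 1) = _ := coeffNat.eq_2 (k + 1) m
    rw [this, if_neg (by omega), if_neg (by omega)]
    rcases k with _ | k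
    · simp
    · rw [if_neg (by omega), if_neg (by omega)]
      push_cast
      ring
  -- Compatibility of the prescribed diagonal with the recursion, which here links two consecutive
  -- diagonal values.
  · rw [h, coeffNat_diagonal, coeffNat_of_lt (by omega), if_neg (by omega),
      show k - 1 = 2 * m by omega, coeffNat_diagonal, Nat.factorial_succ]
    have : (k : ℝ) + 1 = 2 * (m + 1) := by exact_mod_cast h
    rw [this]
    push_cast
    have hm : ((m : ℝ) + 1) ≠ 0 := by positivity
    have hm' : (m.factorial : ℝ) ≠ 0 := by positivity
    field_simp
    ring
  · rw [coeffNat_of_lt (by omega), coeffNat_of_lt (by omega)]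
    split_ifs with hk
    · simp
    · rw [coeffNat_of_lt (by omega)]; simp

lemma isEntryCoeff_coeff : IsEntryCoeff coeff where
  support m k h := by
    by_contra h'
    exact h (coeff_of_neg (by omega))
  recursion m k hk := by
    rcases lt_or_ge m 0 with hm | hm
    · rw [coeff_of_neg (Or.inl hm), coeff_of_neg (Or.inl hm), coeff_of_neg (Or.inl (by omega))]
      simp
    lift m to ℕ using hm
    rcases lt_or_ge k 0 with hk' | hk'
    · rw [coeff_of_neg (Or.inr hk'), coeff_of_neg (m := (m : ℤ) - 1) (Or.inr (by omega))]
      rcases eq_or_ne k (-1) with rfl | h1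
      · simp
      · rw [coeff_of_neg (Or.inr (by omega))]; simp
    lift k to ℕ using hk'
    obtain ⟨k, rfl⟩ : ∃ l, k = l + 1 := ⟨k - 1, by omega⟩
    rw [show (((k + 1 : ℕ) : ℤ) + 1) = (k + 2 : ℕ) by push_cast; ring, coeff_natCast,
      coeff_natCast]
    rcases m with _ | m
    · rw [coeff_of_neg (Or.inl (by simp)), coeffNat_zero_left, coeffNat_zero_left]
      simp
    · have := coeffNat_recursion m k
      rw [show ((m + 1 : ℕ) : ℤ) - 1 = (m : ℕ) by push_cast; ring]
      rcases k with _ | k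
      · rw [coeff_of_neg (m := (m : ℤ)) (Or.inr (by norm_num))]
        simpa using this
      · rw [show ((k + 1 + 1 : ℕ) : ℤ) - 2 = (k : ℕ) by push_cast; ring, coeff_natCast]
        rw [if_neg (by omega), Nat.add_sub_cancel] at this
        push_cast at this ⊢
        exact this
  diagonal m := by
    have := coeff_natCast m (2 * m)
    push_cast at this
    rw [this, coeffNat_diagonal]
  left m hm := by
    lift m to ℕ using by omega
    obtain ⟨m, rfl⟩ : ∃ l, m = l + 1 := ⟨m - 1, by omega⟩
    exact (coeff_natCast (m + 1) 0).trans (coeffNat_zero_right m)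
  bottom k hk := by
    lift k to ℕ using by omega
    obtain ⟨k, rfl⟩ : ∃ l, k = l + 1 := ⟨k - 1, by omega⟩
    exact (coeff_natCast 0 (k + 1)).trans (coeffNat_zero_left k)

/-- The row `m` of a coefficient family is determined by the row `m - 1`. -/
lemma IsEntryCoeff.row_eq {A B : ℤ → ℤ → ℝ} (hA : IsEntryCoeff A) (hB : IsEntryCoeff B) {m : ℕ}
    (h : ∀ k, A ((m : ℤ) - 1) k = B ((m : ℤ) - 1) k) (k : ℕ) : A m k = B m k := by
  have hdiag : A m (2 * m : ℕ) = B m (2 * m : ℕ) := by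
    push_cast
    rw [hA.diagonal, hB.diagonal]
  -- Above the diagonal, solve for `A_{m,k+1}`; the excluded case `k = 0` occurs only for `m = 0`,
  -- where `bottom` applies.
  have up : ∀ j : ℕ, A m (2 * m + j : ℕ) = B m (2 * m + j : ℕ) := by
    intro j
    induction j with
    | zero => exact hdiag
    | succ j ih =>
      rcases Nat.eq_zero_or_pos (2 * m + j) with h0 | h0
      · obtain ⟨rfl, rfl⟩ : m = 0 ∧ j = 0 := by omega
        simp [hA.bottom, hB.bottom]
      · have hk : ((2 * m + j : ℕ) : ℤ) ≠ 0 := by exact_mod_cast h0.ne'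
        have e1 := hA.recursion m _ hk
        have e2 := hB.recursion m _ hk
        rw [ih, h] at e1
        have h1 : ((((2 * m + j : ℕ) : ℤ) : ℝ) + 1) / 3 ≠ 0 := by positivity
        have := mul_left_cancel₀ h1 (show _ * A m ((2 * m + j : ℕ) + 1) = _ * B m ((2 * m + j : ℕ) + 1) by
          linarith)
        exact_mod_cast this
  -- Below the diagonal, solve for `A_{m,k}` down to `k = 1`; `left` supplies `k = 0`.
  have down : ∀ j : ℕ, j ≤ 2 * m → A m (2 * m - j : ℕ) = B m (2 * m - j : ℕ) := by
    intro j
    induction j with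
    | zero => exact fun _ => hdiag
    | succ j ih =>
      intro hj
      rcases eq_or_ne (2 * m - (j + 1)) 0 with h0 | h0
      · rw [h0]
        exact (hA.left m (by omega)).trans (hB.left m (by omega)).symm
      · have hk : ((2 * m - (j + 1) : ℕ) : ℤ) ≠ 0 := by exact_mod_cast h0
        have e1 := hA.recursion m _ hk
        have e2 := hB.recursion m _ hk
        have h1 := ih (by omega)
        rw [show ((2 * m - (j + 1) : ℕ) : ℤ) + 1 = (2 * m - j : ℕ) by omega] at e1 e2
        rw [h1, h] at e1
        linarith
  rcases le_total k (2 * m) with hk | hk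
  · simpa [Nat.sub_sub_self hk] using down (2 * m - k) (by omega)
  · simpa [Nat.add_sub_cancel' hk] using up (k - 2 * m)

lemma IsEntryCoeff.ext {A B : ℤ → ℤ → ℝ} (hA : IsEntryCoeff A) (hB : IsEntryCoeff B) : A = B := by
  have hzero : ∀ {A : ℤ → ℤ → ℝ}, IsEntryCoeff A → ∀ {m k : ℤ}, m < 0 ∨ k < 0 → A m k = 0 := by
    intro A hA m k h
    by_contra h'
    have := hA.support m k h'
    omega
  have key : ∀ m : ℕ, ∀ k, A ((m : ℤ) - 1) k = B ((m : ℤ) - 1) k := by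
    intro m
    induction m with
    | zero => exact fun k => by rw [hzero hA (by simp), hzero hB (by simp)]
    | succ m ih =>
      intro k
      push_cast
      rw [add_sub_cancel_right]
      rcases lt_or_ge k 0 with hk | hk
      · rw [hzero hA (Or.inr hk), hzero hB (Or.inr hk)]
      · lift k to ℕ using hk
        exact hA.row_eq hB ih k
  funext m k
  rcases lt_or_ge m 0 with hm | hm
  · rw [hzero hA (Or.inl hm), hzero hB (Or.inl hm)]
  · lift m to ℕ using hm
    simpa using key (m + 1) k

/-- The normalized entries of the Wronskian, as polynomials in `s`. -/
noncomputable def entryPoly (m : ℕ) : ℂ[X] :=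
  ∑ k ∈ Finset.range (2 * m + 1),
    monomial k (((3 : ℝ) ^ (-(1 / 4) : ℝ) * √3 ^ m * coeffNat m k / 3 ^ k : ℝ) : ℂ)

lemma entryPoly_coeff (m k : ℕ) : (entryPoly m).coeff k =
    (((3 : ℝ) ^ (-(1 / 4) : ℝ) * √3 ^ m * coeffNat m k / 3 ^ k : ℝ) : ℂ) := by
  simp only [entryPoly, finsetSum_coeff, coeff_monomial]
  rw [Finset.sum_ite_eq']
  split_ifs with h
  · rfl
  · rw [coeffNat_of_lt (by simpa using h)]; simp

/-- The weight `√3 ^ m / 3 ^ k` is what turns the constant `3√3` of the recursion into the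
coefficient `-1` of `X * p m`. -/
lemma isChain_entryPoly : IsChain entryPoly where
  zero := by
    have : coeffNat 0 0 = (3 : ℝ) ^ (1 / 4 : ℝ) := by rw [coeffNat]; simp
    have h2 : (3 : ℝ) ^ (-(1 / 4) : ℝ) * (3 : ℝ) ^ (1 / 4 : ℝ) = 1 := by
      rw [← Real.rpow_add (by norm_num)]; simp
    simp only [entryPoly, mul_zero, zero_add, Finset.sum_range_one, pow_zero, this, div_one,
      mul_one, h2, Complex.ofReal_one, monomial_zero_one]
  succ m := by
    ext k
    have h3 : √3 * √3 = (3 : ℝ) := Real.mul_self_sqrt (by norm_num)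
    have h := coeffNat_recursion m k
    rw [coeff_sub, coeff_derivative, coeff_derivative, coeff_derivative, entryPoly_coeff,
      entryPoly_coeff, neg_mul, coeff_neg]
    have hk1 : ((k : ℝ) + 1) ≠ 0 := by positivity
    rcases k with _ | k
    · rw [coeff_X_mul_zero]
      have e : coeffNat (m + 1) (0 + 1 + 1) / 9 * 2 - coeffNat (m + 1) (0 + 1) / 3 = 0 := by
        simp at h ⊢
        linarith
      have : ((3 : ℝ) ^ (-(1 / 4) : ℝ) * √3 ^ (m + 1) * coeffNat (m + 1) (0 + 1 + 1)
          / 3 ^ (0 + 1 + 1)) * 2 -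
        ((3 : ℝ) ^ (-(1 / 4) : ℝ) * √3 ^ (m + 1) * coeffNat (m + 1) (0 + 1) / 3 ^ (0 + 1)) = 0 := by
        linear_combination ((3 : ℝ) ^ (-(1 / 4) : ℝ) * √3 ^ (m + 1)) * e
      have := congrArg (fun x : ℝ => (x : ℂ)) this
      push_cast at this ⊢
      linear_combination this
    · rw [coeff_X_mul, entryPoly_coeff]
      rw [if_neg (by omega), Nat.add_sub_cancel] at h
      have : (((3 : ℝ) ^ (-(1 / 4) : ℝ) * √3 ^ (m + 1) * coeffNat (m + 1) (k + 1 + 1 + 1)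
          / 3 ^ (k + 1 + 1 + 1)) * (k + 1 + 1 + 1)) * (k + 1 + 1) -
        ((3 : ℝ) ^ (-(1 / 4) : ℝ) * √3 ^ (m + 1) * coeffNat (m + 1) (k + 1 + 1)
          / 3 ^ (k + 1 + 1)) * (k + 1 + 1) = -
        ((3 : ℝ) ^ (-(1 / 4) : ℝ) * √3 ^ m * coeffNat m k / 3 ^ k) := by
        push_cast at h hk1
        have h' : ((k : ℝ) + 1 + 1) * (k + 1 + 1 + 1) / 3 * coeffNat (m + 1) (k + 1 + 2)
            - (k + 1 + 1) * coeffNat (m + 1) (k + 1 + 1) + 3 * √3 * coeffNat m k = 0 := by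
          have e : 3 * √3 = ((k : ℝ) + 1 + 1) * (3 * √3 / (k + 1 + 1)) := by field_simp
          rw [e]
          linear_combination ((k : ℝ) + 1 + 1) * h
        linear_combination ((3 : ℝ) ^ (-(1 / 4) : ℝ) * √3 ^ (m + 1) / 3 ^ (k + 2)) * h'
          - ((3 : ℝ) ^ (-(1 / 4) : ℝ) * √3 ^ m * coeffNat m k / 3 ^ k / 3) * h3
      have := congrArg (fun x : ℝ => (x : ℂ)) this
      push_cast at this ⊢
      exact this

end Coefficients


/-! ### Wronskians under a change of variable -/

section ChainRule

/-- Iterated chain rule for polynomials composed with a fixed holomorphic function. -/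
lemma exists_iteratedDeriv_eval_comp {s φ : ℂ → ℂ} {U : Set ℂ} (hU : IsOpen U)
    (hs : ∀ z ∈ U, HasDerivAt s (φ z) z) (hφ : DifferentiableOn ℂ φ U) (i : ℕ) :
    ∃ b : ℕ → ℂ → ℂ, (∀ k, DifferentiableOn ℂ (b k) U) ∧ (∀ z ∈ U, b i z = φ z ^ i) ∧
      (∀ k, i < k → ∀ z ∈ U, b k z = 0) ∧ ∀ f : ℂ[X], ∀ z ∈ U,
        iteratedDeriv i (fun z => f.eval (s z)) z =
          ∑ k ∈ Finset.range (i + 1), b k z * (derivative^[k] f).eval (s z) := by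
  induction i with
  | zero =>
    refine ⟨fun k _ => if k = 0 then 1 else 0, fun k => differentiableOn_const _, ?_, ?_, ?_⟩
    · simp
    · intro k hk z _
      simp [hk.ne']
    · simp
  | succ i ih =>
    obtain ⟨b, hb, hbi, hb0, hbf⟩ := ih
    refine ⟨fun k z => deriv (b k) z + if k = 0 then 0 else φ z * b (k - 1) z,
      fun k => (hb k).deriv hU |>.add ?_, fun z hz => ?_, fun k hk z hz => ?_, fun f z hz => ?_⟩
    · rcases k with _ | k
      · simp
      · simpa using hφ.fun_mul (hb k)
    · have : b (i + 1) =ᶠ[nhds z] fun _ => 0 := by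
        filter_upwards [hU.mem_nhds hz] with y hy using hb0 _ (Nat.lt_succ_self i) y hy
      simp [this.deriv_eq, hbi z hz, pow_succ']
    · have : b k =ᶠ[nhds z] fun _ => 0 := by
        filter_upwards [hU.mem_nhds hz] with y hy using hb0 _ (by omega) y hy
      simp [this.deriv_eq, hb0 (k - 1) (by omega) z hz]
    · have h1 : iteratedDeriv i (fun z => f.eval (s z)) =ᶠ[nhds z] fun z =>
          ∑ k ∈ Finset.range (i + 2), b k z * (derivative^[k] f).eval (s z) := by
        filter_upwards [hU.mem_nhds hz] with y hy
        rw [hbf f y hy, Finset.sum_range_succ _ (i + 1), hb0 _ (Nat.lt_succ_self i) y hy,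
          zero_mul, add_zero]
      have h2 : ∀ k ∈ Finset.range (i + 2), HasDerivAt
          (fun z => b k z * (derivative^[k] f).eval (s z))
          (deriv (b k) z * (derivative^[k] f).eval (s z)
            + b k z * ((derivative^[k + 1] f).eval (s z) * φ z)) z := by
        intro k _
        rw [Function.iterate_succ_apply']
        exact ((hb k).differentiableAt (hU.mem_nhds hz)).hasDerivAt.mul
          (((derivative^[k] f).hasDerivAt (s z)).comp z (hs z hz))
      rw [iteratedDeriv_succ, h1.deriv_eq, (HasDerivAt.fun_sum h2).deriv]
      simp only [add_mul, Finset.sum_add_distrib]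
      congr 1
      conv_rhs => rw [Finset.sum_range_succ']
      rw [Finset.sum_range_succ, hb0 _ (Nat.lt_succ_self i) z hz]
      simp only [zero_mul, add_zero, if_true, Nat.add_eq_zero_iff, one_ne_zero, and_false,
        if_false, Nat.add_sub_cancel]
      exact Finset.sum_congr rfl fun k _ => by ring

/-- The chain rule factors the matrix as a lower triangular one, with diagonal `φ ^ i`, times the
matrix of derivatives in `s`. -/
lemma wronskian_eval_comp {s φ : ℂ → ℂ} {U : Set ℂ} (hU : IsOpen U)
    (hs : ∀ z ∈ U, HasDerivAt s (φ z) z) (hφ : DifferentiableOn ℂ φ U) (q : ℕ → ℂ[X]) (N : ℕ)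
    {z : ℂ} (hz : z ∈ U) :
    wronskian (fun (j : Fin N) z => (q j).eval (s z)) z =
      (∏ i ∈ Finset.range N, φ z ^ i) * (polyWronskian q N).eval (s z) := by
  choose b _ hbi hb0 hbf using exists_iteratedDeriv_eval_comp hU hs hφ
  set L : Matrix (Fin N) (Fin N) ℂ := Matrix.of fun i k => b i k z with hL
  set P : Matrix (Fin N) (Fin N) ℂ :=
    Matrix.of fun k j : Fin N => (derivative^[k] (q j)).eval (s z) with hP
  have h1 : (Matrix.of fun i j : Fin N => iteratedDeriv i (fun z => (q j).eval (s z)) z) =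
      L * P := by
    ext i j
    simp only [Matrix.of_apply, Matrix.mul_apply, hL, hP]
    rw [hbf i (q j) z hz, ← Finset.sum_range
      (fun k => b i k z * (derivative^[k] (q j)).eval (s z))]
    refine Finset.sum_subset (Finset.range_subset_range.2 i.2) fun k _ hk => ?_
    rw [hb0 i k (by simpa using hk) z hz, zero_mul]
  have h2 : L.det = ∏ i ∈ Finset.range N, φ z ^ i := by
    rw [Matrix.det_of_isLowerTriangular L fun i k hik => hb0 i k hik z hz,
      Finset.prod_range]
    exact Finset.prod_congr rfl fun i _ => hbi i z hz
  have h3 : P.det = (polyWronskian q N).eval (s z) := by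
    rw [polyWronskian, ← coe_evalRingHom, RingHom.map_det]
    rfl
  rw [wronskian, h1, Matrix.det_mul, h2, h3]

lemma polyWronskian_C_mul (c : ℕ → ℂ) (p : ℕ → ℂ[X]) (N : ℕ) :
    polyWronskian (fun j => C (c j) * p j) N =
      C (∏ j ∈ Finset.range N, c j) * polyWronskian p N := by
  unfold polyWronskian
  rw [map_prod, Finset.prod_range, ← Matrix.det_mul_row]
  congr 1
  ext i j : 2
  simp [iterate_derivative_C_mul]

end ChainRule

/-! ### The variable `s` and principal branches -/

section SVariable

/-- The cube root of `z / 2`. -/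
noncomputable def cubeRoot (z : ℂ) : ℂ := (z / 2) ^ (1 / 3 : ℂ)

lemma half_mem_slitPlane {z : ℂ} (hz : z ∈ Complex.slitPlane) : z / 2 ∈ Complex.slitPlane := by
  rw [Complex.mem_slitPlane_iff] at hz ⊢
  rcases hz with h | h
  · left; simpa using h
  · right; simpa using h

lemma cubeRoot_ne_zero {z : ℂ} (hz : z ∈ Complex.slitPlane) : cubeRoot z ≠ 0 := by
  rw [cubeRoot, Complex.cpow_ne_zero_iff]
  exact Or.inl (Complex.slitPlane_ne_zero (half_mem_slitPlane hz))

lemma sVar_eq (z : ℂ) : sVar z = 3 * cubeRoot z ^ 2 := by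
  rw [sVar, cubeRoot, ← Complex.cpow_nat_mul]
  norm_num

lemma hasDerivAt_sVar {z : ℂ} (hz : z ∈ Complex.slitPlane) :
    HasDerivAt sVar (cubeRoot z)⁻¹ z := by
  have h := (((hasDerivAt_id z).div_const 2).cpow_const (c := (2 / 3 : ℂ))
    (half_mem_slitPlane hz)).const_mul 3
  refine h.congr_deriv ?_
  rw [cubeRoot, ← Complex.cpow_neg]
  norm_num
  ring

lemma differentiableOn_inv_cubeRoot :
    DifferentiableOn ℂ (fun z => (cubeRoot z)⁻¹) Complex.slitPlane := fun z hz =>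
  (((hasDerivAt_id z).div_const 2).cpow_const (c := (1 / 3 : ℂ))
    (half_mem_slitPlane hz)).differentiableAt.differentiableWithinAt.inv (cubeRoot_ne_zero hz)

/-- The exponents multiply on principal branches because `2/3` of an argument stays in `(-π, π]`. -/
lemma sVar_div_three_cpow (z : ℂ) (k : ℕ) :
    (sVar z / 3) ^ ((k : ℂ) / 2) = cubeRoot z ^ k := by
  have h1 : sVar z / 3 = (z / 2) ^ (2 / 3 : ℂ) := by rw [sVar]; ring
  have h2 : (Complex.log (z / 2) * (2 / 3)).im = (z / 2).arg * (2 / 3) := by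
    rw [show (2 / 3 : ℂ) = ((2 / 3 : ℝ) : ℂ) by push_cast; rfl, Complex.im_mul_ofReal,
      Complex.log_im]
  have h3 := Complex.neg_pi_lt_arg (z / 2)
  have h4 := Complex.arg_le_pi (z / 2)
  have h5 := Real.pi_pos
  rw [h1, ← Complex.cpow_mul _ (by rw [h2]; linarith) (by rw [h2]; linarith), cubeRoot,
    ← Complex.cpow_nat_mul]
  congr 1
  ring

end SVariable

/-! ### The entries in terms of the chain, and the scalar factors -/

section Entries

/-- The fourth root of `3`. -/
noncomputable def root : ℝ := (3 : ℝ) ^ (1 / 4 : ℝ)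

lemma root_pos : 0 < root := by unfold root; positivity

lemma root_sq : root ^ 2 = √3 := by
  rw [root, ← Real.rpow_natCast, ← Real.rpow_mul (by norm_num), Real.sqrt_eq_rpow]
  norm_num

lemma root_pow_four : root ^ 4 = 3 := by
  rw [show root ^ 4 = (root ^ 2) ^ 2 by ring, root_sq]
  norm_num

lemma root_inv : (3 : ℝ) ^ (-(1 / 4) : ℝ) = root⁻¹ := Real.rpow_neg (by norm_num) _

lemma root_inv' : (3 : ℂ) ^ (-(1 / 4) : ℂ) = (root : ℂ)⁻¹ := by
  rw [← Complex.ofReal_inv, ← root_inv, Complex.ofReal_cpow (by norm_num)]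
  norm_num

lemma entry_eq {δ : ℤ} (hδ : δ = 1 ∨ δ = -1) (j : ℕ) (z : ℂ) :
    entry (δ * ((j : ℤ) + 1)) z =
      (C ((root : ℂ) * ((root : ℂ) ^ 2)⁻¹ ^ j) * entryPoly j).eval (δ * sVar z) := by
  have h1 : (δ * ((j : ℤ) + 1)).natAbs = j + 1 := by rcases hδ with rfl | rfl <;> omega
  have h2 : |δ * ((j : ℤ) + 1)| = j + 1 := by
    rw [Int.abs_eq_natAbs, h1, Nat.cast_succ]
  have h3 : (δ * ((j : ℤ) + 1)).sign = δ := by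
    rw [Int.sign_mul, Int.sign_eq_one_of_pos (by omega : (0 : ℤ) < j + 1)]
    rcases hδ with rfl | rfl <;> simp
  rw [entry, h1, h2, h3, add_sub_cancel_right, show 2 * (j + 1) - 1 = 2 * j + 1 by omega,
    entryPoly, eval_C_mul, eval_finsetSum, Finset.mul_sum]
  refine Finset.sum_congr rfl fun k _ => ?_
  rw [coeff_natCast, eval_monomial, root_inv, ← root_sq]
  have := root_pos.ne'
  have h4 : (root : ℂ) ≠ 0 := by exact_mod_cast this
  push_cast
  rw [div_pow, inv_pow]
  field_simp

lemma entryWronskian_eq {δ : ℤ} (hδ : δ = 1 ∨ δ = -1) {N : ℕ} (hN : N ≠ 0) {z : ℂ}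
    (hz : z ∈ Complex.slitPlane) :
    entryWronskian (δ * N) z =
      (∏ j ∈ Finset.range N, ((root : ℂ) * ((root : ℂ) ^ 2)⁻¹ ^ j * (δ / cubeRoot z) ^ j)) *
        (polyWronskian entryPoly N).eval (δ * sVar z) := by
  have h1 : (δ * (N : ℤ)).natAbs = N := by rcases hδ with rfl | rfl <;> simp
  have h2 : (δ * (N : ℤ)).sign = δ := by
    rw [Int.sign_mul, Int.sign_eq_one_of_pos (by omega : (0 : ℤ) < N)]
    rcases hδ with rfl | rfl <;> simp
  have h3 := wronskian_eval_comp Complex.isOpen_slitPlane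
    (s := fun z => δ * sVar z) (φ := fun z => δ / cubeRoot z)
    (fun z hz => (hasDerivAt_sVar hz).const_mul (δ : ℂ))
    (differentiableOn_inv_cubeRoot.const_mul (δ : ℂ))
    (fun j => C ((root : ℂ) * ((root : ℂ) ^ 2)⁻¹ ^ j) * entryPoly j) N hz
  rw [entryWronskian, h1, h2]
  rw [show (fun j : Fin N => entry (δ * ((j : ℤ) + 1))) = fun (j : Fin N) z =>
      (C ((root : ℂ) * ((root : ℂ) ^ 2)⁻¹ ^ (j : ℕ)) * entryPoly j).eval (δ * sVar z) from
    funext₂ fun j z => entry_eq hδ j z, h3, polyWronskian_C_mul, eval_C_mul, ← mul_assoc, ← Finset.prod_mul_distrib]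
  congr 1
  exact Finset.prod_congr rfl fun j _ => mul_comm _ _

/-- The scalar factor relating the Wronskian in `z` to the reduced Wronskian in `s`. -/
lemma prod_mul_pow_wronskianOrder {θ t δ : ℂ} (hθ : θ ≠ 0) (ht : t ≠ 0) (hδ : δ = 1 ∨ δ = -1)
    (k : ℕ) :
    (∏ j ∈ Finset.range (2 * k), (θ * (θ ^ 2)⁻¹ ^ j * (δ / t) ^ j)) *
        (δ * (θ ^ 4 * t ^ 2)) ^ wronskianOrder (2 * k) = δ ^ k * t⁻¹ ^ k ∧
      (∏ j ∈ Finset.range (2 * k + 1), (θ * (θ ^ 2)⁻¹ ^ j * (δ / t) ^ j)) *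
        (δ * (θ ^ 4 * t ^ 2)) ^ wronskianOrder (2 * k + 1) = θ * t⁻¹ ^ k := by
  have hδ2 : δ ^ 2 = 1 := by rcases hδ with rfl | rfl <;> norm_num
  -- For `j = 2k` the factor, times its share `⌊j/2⌋` of the power, is `θ δ^k`; for `j = 2k + 1` it
  -- is `δ^(k+1) / (θ t)`. A pair thus contributes `δ / t`.
  have step : ∀ k : ℕ, (∏ j ∈ Finset.range (2 * k), (θ * (θ ^ 2)⁻¹ ^ j * (δ / t) ^ j)) *
      (δ * (θ ^ 4 * t ^ 2)) ^ wronskianOrder (2 * k) = δ ^ k * t⁻¹ ^ k →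
      (∏ j ∈ Finset.range (2 * k + 1), (θ * (θ ^ 2)⁻¹ ^ j * (δ / t) ^ j)) *
        (δ * (θ ^ 4 * t ^ 2)) ^ wronskianOrder (2 * k + 1) = θ * t⁻¹ ^ k := by
    intro k h
    have e : ((θ ^ 2)⁻¹ * (δ / t)) ^ 2 * (δ * (θ ^ 4 * t ^ 2)) * δ = 1 := by
      field_simp
      linear_combination (δ ^ 2 + 1) * hδ2
    rw [Finset.prod_range_succ, wronskianOrder_succ, Nat.mul_div_cancel_left k two_pos, pow_add]
    calc _ = ((∏ j ∈ Finset.range (2 * k), (θ * (θ ^ 2)⁻¹ ^ j * (δ / t) ^ j)) *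
          (δ * (θ ^ 4 * t ^ 2)) ^ wronskianOrder (2 * k)) * θ *
          (((θ ^ 2)⁻¹ * (δ / t)) ^ 2 * (δ * (θ ^ 4 * t ^ 2))) ^ k := by
          rw [mul_pow _ (δ * _), ← pow_mul, mul_pow _ (δ / t)]; ring
      _ = θ * t⁻¹ ^ k * (((θ ^ 2)⁻¹ * (δ / t)) ^ 2 * (δ * (θ ^ 4 * t ^ 2)) * δ) ^ k := by
          rw [h, mul_pow _ δ]; ring
      _ = _ := by rw [e, one_pow, mul_one]
  induction k with
  | zero => exact ⟨by simp [wronskianOrder], by simp [wronskianOrder]⟩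
  | succ k ih =>
    refine (fun h => ⟨h, step _ h⟩) ?_
    have e : ((θ ^ 2)⁻¹ * (δ / t)) ^ 2 * (δ * (θ ^ 4 * t ^ 2)) = δ := by
      field_simp
      linear_combination δ * hδ2
    rw [show 2 * (k + 1) = 2 * k + 1 + 1 by ring, Finset.prod_range_succ,
      wronskianOrder_succ (2 * k + 1), show (2 * k + 1) / 2 = k by omega, pow_add]
    calc _ = ((∏ j ∈ Finset.range (2 * k + 1), (θ * (θ ^ 2)⁻¹ ^ j * (δ / t) ^ j)) *
          (δ * (θ ^ 4 * t ^ 2)) ^ wronskianOrder (2 * k + 1)) * θ *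
          ((θ ^ 2)⁻¹ * (δ / t)) *
          (((θ ^ 2)⁻¹ * (δ / t)) ^ 2 * (δ * (θ ^ 4 * t ^ 2))) ^ k := by
          rw [mul_pow _ (δ * _), ← pow_mul, mul_pow _ (δ / t)]; ring
      _ = _ := by
          rw [ih.2, e, inv_pow, inv_pow]
          field_simp
          ring

end Entries

/-! ### Assembly of the Wronskian formula -/

section Assembly

lemma exists_polyWronskian_entryPoly : ∃ σ : ℕ → ℂ[X], ohyama = extend σ ∧ σ 0 = 1 ∧
    IsOhyamaSequence (extend σ) ∧ (∀ n, extend σ n ≠ 0) ∧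
    ∀ n, polyWronskian entryPoly n = X ^ wronskianOrder n * σ n := by
  obtain ⟨σ, h0, h1, hne, hσ, hT⟩ := isChain_entryPoly.exists_ohyama_half
  have hs := isOhyamaSequence_extend h0 h1 hT
  have hs0 := extend_ne_zero hne
  exact ⟨σ, hs.ohyama_eq hs0, h0, hs, hs0, hσ⟩

lemma eval_extend {σ : ℕ → ℂ[X]} (h0 : σ 0 = 1) {δ : ℤ} (hδ : δ = 1 ∨ δ = -1) (k : ℕ) (s : ℂ) :
    (extend σ (δ * (2 * k : ℕ))).eval s = δ ^ k * (σ (2 * k)).eval (δ * s) ∧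
      (extend σ (δ * (2 * k + 1 : ℕ))).eval s = (σ (2 * k + 1)).eval (δ * s) := by
  have h : reflectionSign (2 * k) = (-1) ^ k := by simp [reflectionSign]
  have h' : reflectionSign (2 * k + 1) = 1 := by simp [reflectionSign]
  rcases hδ with rfl | rfl
  · rw [one_mul, one_mul, extend_natCast, extend_natCast]
    simp
  · rw [neg_one_mul, neg_one_mul, extend_neg_natCast h0, extend_neg_natCast h0, h, h']
    simp [eval_comp]

/-- The factor `δ ^ k` from the change of variable at even indices is exactly the reflection sign in
`eval_extend`. -/
lemma ohyama_eval_eq {δ : ℤ} (hδ : δ = 1 ∨ δ = -1) (k : ℕ) {z : ℂ}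
    (hz : z ∈ Complex.slitPlane) :
    (k ≠ 0 → (ohyama (δ * (2 * k : ℕ))).eval (sVar z) =
      cubeRoot z ^ k * entryWronskian (δ * (2 * k : ℕ)) z) ∧
    (ohyama (δ * (2 * k + 1 : ℕ))).eval (sVar z) =
      (root : ℂ)⁻¹ * cubeRoot z ^ k * entryWronskian (δ * (2 * k + 1 : ℕ)) z := by
  obtain ⟨σ, hσ, h0, -, -, hW⟩ := exists_polyWronskian_entryPoly
  have hδ' : (δ : ℂ) = 1 ∨ (δ : ℂ) = -1 := by rcases hδ with rfl | rfl <;> simp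
  have hθ : (root : ℂ) ≠ 0 := by exact_mod_cast root_pos.ne'
  have ht := cubeRoot_ne_zero hz
  have hθ4 : (root : ℂ) ^ 4 = 3 := by exact_mod_cast root_pow_four
  obtain ⟨hp0, hp1⟩ := prod_mul_pow_wronskianOrder hθ ht hδ' k
  rw [hθ4, ← sVar_eq] at hp0 hp1
  obtain ⟨he0, he1⟩ := eval_extend h0 hδ k (sVar z)
  rw [hσ, he0, he1]
  refine ⟨fun hk => ?_, ?_⟩
  · rw [entryWronskian_eq hδ (by omega) hz, hW, eval_mul, eval_pow, eval_X,
      ← mul_assoc _ _ (eval _ _), hp0, inv_pow]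
    field_simp
  · rw [entryWronskian_eq hδ (by omega) hz, hW, eval_mul, eval_pow, eval_X,
      ← mul_assoc _ _ (eval _ _), hp1, inv_pow]
    field_simp

end Assembly

end Ohyama

theorem theorem4p1 :
    (Ohyama.IsOhyamaSequence Ohyama.ohyama ∧
      ∀ ρ : ℤ → ℂ[X], Ohyama.IsOhyamaSequence ρ → ρ = Ohyama.ohyama) ∧
    (Ohyama.IsEntryCoeff Ohyama.coeff ∧
      ∀ A : ℤ → ℤ → ℝ, Ohyama.IsEntryCoeff A → A = Ohyama.coeff) ∧
    ∀ n : ℤ, ∀ z ∈ Complex.slitPlane,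
      (Odd n → (Ohyama.ohyama n).eval (Ohyama.sVar z) =
        (3 : ℂ) ^ (-(1 / 4) : ℂ) * (Ohyama.sVar z / 3) ^ (((|n| : ℤ) - 1 : ℂ) / 4)
          * Ohyama.entryWronskian n z) ∧
      (Even n → (Ohyama.ohyama n).eval (Ohyama.sVar z) =
        (Ohyama.sVar z / 3) ^ (((|n| : ℤ) : ℂ) / 4) * Ohyama.entryWronskian n z) := by
  obtain ⟨σ, hσ, -, hs, hs0, -⟩ := Ohyama.exists_polyWronskian_entryPoly
  refine ⟨⟨hσ ▸ hs, fun ρ hρ => hσ ▸ hs.eq_of_ne_zero hρ hs0⟩,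
    ⟨Ohyama.isEntryCoeff_coeff, fun A hA => hA.ext Ohyama.isEntryCoeff_coeff⟩,
    fun n z hz => ?_⟩
  obtain ⟨δ, N, hδ, rfl⟩ : ∃ (δ : ℤ) (N : ℕ), (δ = 1 ∨ δ = -1) ∧ n = δ * N := by
    obtain ⟨N, rfl | rfl⟩ := n.eq_nat_or_neg
    · exact ⟨1, N, Or.inl rfl, by simp⟩
    · exact ⟨-1, N, Or.inr rfl, by simp⟩
  have habs : |δ * (N : ℤ)| = N := by rcases hδ with rfl | rfl <;> simp
  have hev : Even (δ * (N : ℤ)) ↔ Even N := by rcases hδ with rfl | rfl <;> simp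
  rw [habs, ← Int.not_even_iff_odd, hev, Nat.not_even_iff_odd]
  refine ⟨?_, ?_⟩
  · rintro ⟨k, rfl⟩
    rw [(Ohyama.ohyama_eval_eq hδ k hz).2, Ohyama.root_inv', ← Ohyama.sVar_div_three_cpow]
    congr 3
    push_cast
    ring
  · intro h
    obtain ⟨k, rfl⟩ := even_iff_exists_two_mul.1 h
    -- Index `0` is separate: its sign is `0`, not `δ`, and the Wronskian is empty.
    rcases eq_or_ne k 0 with rfl | hk
    · have h0 : Ohyama.entryWronskian 0 z = 1 := Matrix.det_fin_zero
      simp [Ohyama.ohyama, Ohyama.half, h0]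
    · rw [(Ohyama.ohyama_eval_eq hδ k hz).1 hk, ← Ohyama.sVar_div_three_cpow]
      congr 2
      push_cast
      ring
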